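/- All graphs are finite and simple. For integers $r,t\ge 1$, a graph is $\{P_r,K_{2,t}\}$-free if no induced subgraph of it is isomorphic to the path $P_r$ on $r$ vertices or to the complete bipartite graph $K_{2,t}$. For a set $X$ of vertices of a graph $G$, let $\alpha(X)$ be the maximum size of an independent set of the induced subgraph $G[X]$. A tree-decomposition of $G$ consists of a tree $T$ and a non-null subtree $T_v$ of $T$ for each vertex $v$ of $G$ such that $T_u$ and $T_v$ share a node whenever $uv$ is an edge of $G$; the bag of a node $x$ of $T$ is $X_x=\{v : x\in V(T_v)\}$. The tree-independence number of $G$ is the minimum, over all tree-decompositions of $G$, of $\max_{x\in V(T)}\alpha(X_x)$. Say that a function $g:\mathbb N\to\mathbb N$ has property $(\ast)$ if for every integer $t\ge 2$, every connected $\{P_6,K_{2,t}\}$-free graph $G$ and every weighting $w:V(G)\to\mathbb R_{\ge 0}$ with $\sum_{v\in V(G)}w(v)=1$ there are a vertex $z_0\in V(G)$ and a set $Z\subseteq V(G)$ with $\alpha(Z)\le g(t)$ such that every connected component of $G-(N[z_0]\cup Z)$ has total weight at most $7/8$, where $N[z_0]$ is the closed neighbourhood of $z_0$. **Theorem.** 1.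 For every integer $t\ge 2$ there is an integer $s$ such that every $\{P_6,K_{2,t}\}$-free graph has tree-independence number at most $s$. 2. There is a function $g:\mathbb N\to\mathbb N$ with property $(\ast)$, and for every function $g$ with property $(\ast)$ and every integer $t\ge 2$, every $\{P_6,K_{2,t}\}$-free graph has tree-independence number at most $238(t-1)+34\,g(t)+119$. 3. For all integers $r$ and $t$ with $1\le r\le 6$ and $t\ge 1$ there is an integer $s$ such that every $\{P_r,K_{2,t}\}$-free graph has tree-independence number at most $s$. -/

import Mathlib

open scoped NNReal

universe u

namespace SimpleGraph

variable {V : Type u}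

/-- `G` is `{P_r, K_{2,t}}`-free: no induced subgraph of `G` is isomorphic to the path on `r`
vertices or to the complete bipartite graph with parts of sizes `2` and `t`. -/
def IsPathBicliqueFree (r t : ℕ) (G : SimpleGraph V) : Prop :=
  ¬ (pathGraph r).IsIndContained G ∧
    ¬ (completeBipartiteGraph (Fin 2) (Fin t)).IsIndContained G

/-- The independence number of the subgraph of `G` induced by the vertex set `X`. -/
noncomputable def indepNumOn (G : SimpleGraph V) (X : Set V) : ℕ :=
  (G.induce X).indepNum

/-- A tree-decomposition of `G`: a (finite) tree together with a non-null subtree for each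
vertex of `G`, such that the subtrees of any two adjacent vertices share a node. A subtree of a
tree is an induced subgraph, so it is given by its set of nodes. -/
structure TreeDecomposition (G : SimpleGraph V) where
  /-- The nodes of the tree. -/
  Node : Type
  finite_node : Finite Node
  /-- The tree. -/
  tree : SimpleGraph Node
  isTree : tree.IsTree
  /-- The node set of the subtree of a vertex. -/
  subtree : V → Set Node
  subtree_connected : ∀ v, (tree.induce (subtree v)).Connected
  exists_common_node : ∀ u v, G.Adj u v → (subtree u ∩ subtree v).Nonempty

namespace TreeDecomposition

variable {G : SimpleGraph V}

/-- The bag of a node: the vertices whose subtree contains the node. -/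
def bag (D : G.TreeDecomposition) (i : D.Node) : Set V := {v | i ∈ D.subtree v}

/-- The maximum, over the nodes of the tree, of the independence number of the bag. -/
noncomputable def alphaWidth (D : G.TreeDecomposition) : ℕ := ⨆ i, G.indepNumOn (D.bag i)

/-- The supremum in `alphaWidth` is a genuine maximum. -/
theorem alphaWidth_le_iff (D : G.TreeDecomposition) (k : ℕ) :
    D.alphaWidth ≤ k ↔ ∀ i, G.indepNumOn (D.bag i) ≤ k := by
  have := D.finite_node
  have : Nonempty D.Node := D.isTree.1.nonempty
  exact ciSup_le_iff (Set.finite_range _).bddAbove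

/-- Every graph has the tree-decomposition with a single bag. -/
instance : Nonempty G.TreeDecomposition :=
  ⟨{ Node := Unit
     finite_node := inferInstance
     tree := ⊥
     isTree := IsTree.of_subsingleton
     subtree := fun _ => Set.univ
     subtree_connected := fun _ =>
       haveI : Nonempty (Set.univ : Set Unit) := ⟨⟨(), trivial⟩⟩
       Connected.mk (fun a b => (Subsingleton.elim a b) ▸ Reachable.refl a)
     exists_common_node := fun _ _ _ => ⟨(), trivial, trivial⟩ }⟩

end TreeDecomposition

/-- The tree-independence number of `G`: the minimum of the `α`-widths of its
tree-decompositions. -/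
noncomputable def treeIndepNum (G : SimpleGraph V) : ℕ :=
  ⨅ D : G.TreeDecomposition, D.alphaWidth

/-- The infimum in `treeIndepNum` is a genuine minimum. -/
theorem exists_alphaWidth_eq_treeIndepNum (G : SimpleGraph V) :
    ∃ D : G.TreeDecomposition, D.alphaWidth = G.treeIndepNum :=
  Nat.sInf_mem (Set.range_nonempty _)

/-- The total weight of a set of vertices. -/
noncomputable def setWeight [Fintype V] (w : V → ℝ≥0) (X : Set V) : ℝ≥0 :=
  ∑ v, X.indicator w v

/-- `S` is a `(w, c)`-balanced separator of `G`: every component of `G - S` has weight at most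
`c` times the total weight of `G`. -/
def IsBalancedSeparator [Fintype V] (G : SimpleGraph V) (w : V → ℝ≥0) (c : ℝ≥0) (S : Set V) :
    Prop :=
  ∀ D : (G.induce Sᶜ).ConnectedComponent,
    setWeight w (Subtype.val '' D.supp) ≤ c * setWeight w Set.univ

end SimpleGraph

/-- The property of a function `g : ℕ → ℕ` that, for every `t ≥ 2`, every connected
`{P_6, K_{2,t}}`-free graph `G` and every weighting `w` of `G` with total weight `1`, there are a
vertex `z₀` and a set `Z` of vertices with `α(Z) ≤ g t` such that the union of `Z` with the
closed neighbourhood of `z₀` is a `(w, 7/8)`-balanced separator of `G`. -/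
def IsSeparatorFunction (g : ℕ → ℕ) : Prop :=
  ∀ t : ℕ, 2 ≤ t → ∀ (V : Type u) [Fintype V] (G : SimpleGraph V),
    G.Connected → G.IsPathBicliqueFree 6 t →
    ∀ w : V → ℝ≥0, SimpleGraph.setWeight w Set.univ = 1 →
      ∃ (z₀ : V) (Z : Set V), G.indepNumOn Z ≤ g t ∧
        G.IsBalancedSeparator w (7 / 8) (insert z₀ (G.neighborSet z₀) ∪ Z)

/-! Call a connected set heavy if it carries more than 7/8 of the total weight; two heavy sets
always meet. A set is a light separator if every heavy connected set meets it. The aim is a light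
separator of bounded independence number for every weighting, since these yield a
tree-decomposition.

Excluding `P_6` gives a first light separator: the Gyárfás path argument covers one by five closed
neighbourhoods (`hasNbhdSeparators_five`). Closed neighbourhoods may have large independence number,
so they are traded away one at a time (`HasNbhdSeparators.exists_of_succ`). The trade rests on
`exists_separator_of_not_adj`: for nonadjacent `u`, `v`, some set of independence number at most
`6(t-1)+2` meets every connected set that touches both `N[u]` and `N[v]`. As heavy sets meet, once
this set is deleted together with the other deleted sets, either no heavy connected set touches
`N[u]` or none touches `N[v]`, and that neighbourhood becomes superfluous. Nonadjacent centres exist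
because otherwise the centres could be collected into an ever larger clique.

Five trades leave no neighbourhood, which gives a function `g`. For an arbitrary `g` with the
separator property a single trade suffices. The recursion in `exists_hasTreeDecompositionOn` turns
separators of independence number `d` into bags of independence number at most `17d`. -/

namespace SimpleGraph
-- Independence numbers of vertex sets and the two forbidden subgraphs.
section Basics
variable {V : Type u} {G : SimpleGraph V}

theorem indepNumOn_le_iff [Finite V] {X : Set V} {n : ℕ} :
    G.indepNumOn X ≤ n ↔ ∀ s : Finset V, (↑s : Set V) ⊆ X → G.IsIndepSet (s : Set V) → s.card ≤ n := by
  classical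
  constructor
  · intro h s hs hi
    refine le_trans ?_ h
    have : (s.subtype (· ∈ X)).card = s.card := by
      rw [Finset.card_subtype, Finset.filter_true_of_mem]
      exact fun x hx => hs hx
    rw [← this]
    refine IsIndepSet.card_le_indepNum (G := G.induce X) ?_
    intro a ha b hb hab
    rw [Finset.mem_coe, Finset.mem_subtype] at ha hb
    exact hi ha hb (fun h => hab (Subtype.ext h))
  · intro h
    obtain ⟨s, hs⟩ := exists_isNIndepSet_indepNum (G := G.induce X)
    have := h (s.map (Function.Embedding.subtype _)) (by intro x; simp; tauto) (by
      intro a ha b hb hab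
      simp only [Finset.coe_map, Function.Embedding.subtype_apply, Set.mem_image] at ha hb
      obtain ⟨a, ha, rfl⟩ := ha
      obtain ⟨b, hb, rfl⟩ := hb
      exact hs.1 ha hb (fun h => hab (by rw [h])))
    rw [Finset.card_map, hs.2] at this
    exact this

theorem exists_isIndepSet_card_eq_indepNumOn [Finite V] (X : Set V) :
    ∃ s : Finset V, (↑s : Set V) ⊆ X ∧ G.IsIndepSet (s : Set V) ∧ s.card = G.indepNumOn X := by
  by_contra! h
  rcases Nat.eq_zero_or_pos (G.indepNumOn X) with h0 | h0
  · exact h ∅ (by simp) (by simp) (by simp [h0])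
  · have : G.indepNumOn X ≤ G.indepNumOn X - 1 := indepNumOn_le_iff.2 fun s hs hi => by
      have h1 := h s hs hi
      have h2 := indepNumOn_le_iff.1 le_rfl s hs hi
      omega
    omega

theorem card_le_indepNumOn [Finite V] {X : Set V} {s : Finset V} (hs : (↑s : Set V) ⊆ X)
    (hi : G.IsIndepSet (s : Set V)) : s.card ≤ G.indepNumOn X :=
  indepNumOn_le_iff.1 le_rfl s hs hi

theorem indepNumOn_mono [Finite V] {X Y : Set V} (h : X ⊆ Y) : G.indepNumOn X ≤ G.indepNumOn Y :=
  indepNumOn_le_iff.2 fun _ hs hi => card_le_indepNumOn (hs.trans h) hi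

theorem indepNumOn_union_le [Finite V] (X Y : Set V) :
    G.indepNumOn (X ∪ Y) ≤ G.indepNumOn X + G.indepNumOn Y := by
  classical
  refine indepNumOn_le_iff.2 fun s hs hi => ?_
  rw [← Finset.card_filter_add_card_filter_not (s := s) (· ∈ X)]
  refine add_le_add (card_le_indepNumOn ?_ (hi.mono ?_)) (card_le_indepNumOn ?_ (hi.mono ?_))
  · intro x hx; simp at hx; exact hx.2
  · intro x hx; simp at hx; exact hx.1
  · intro x hx
    simp at hx
    exact (hs hx.1).resolve_left hx.2
  · intro x hx; simp at hx; exact hx.1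

theorem indepNumOn_le_one_of_isClique [Finite V] {X : Set V} (h : G.IsClique X) :
    G.indepNumOn X ≤ 1 := by
  refine indepNumOn_le_iff.2 fun s hs hi => Finset.card_le_one.2 fun a ha b hb => ?_
  by_contra hab
  exact hi ha hb hab (h (hs ha) (hs hb) hab)

theorem indepNumOn_singleton_le [Finite V] (v : V) : G.indepNumOn {v} ≤ 1 :=
  indepNumOn_le_one_of_isClique (by simp)

theorem indepNumOn_empty [Finite V] : G.indepNumOn ∅ = 0 :=
  Nat.le_zero.1 (indepNumOn_le_iff.2 fun s hs _ => by simpa using hs)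

theorem two_of_not_isClique {X : Set V} (h : ¬ G.IsClique X) :
    ∃ a ∈ X, ∃ b ∈ X, a ≠ b ∧ ¬ G.Adj a b := by
  simpa [IsClique, Set.Pairwise] using h

/-- Every connected set that avoids `S` contains at most `7 / 8` of the total weight. -/
def IsLightSeparator [Fintype V] (G : SimpleGraph V) (w : V → ℝ≥0) (S : Set V) : Prop :=
  ∀ C : Set V, (G.induce C).Connected → Disjoint C S → 8 * setWeight w C ≤ 7 * setWeight w Set.univ

/-- The closed neighbourhood of a set of vertices. -/
def closedNbhd (G : SimpleGraph V) (X : Set V) : Set V := {v | ∃ x ∈ X, v = x ∨ G.Adj x v}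

theorem IsLightSeparator.mono [Fintype V] {w : V → ℝ≥0} {S T : Set V}
    (h : G.IsLightSeparator w S) (hST : S ⊆ T) : G.IsLightSeparator w T :=
  fun C hC hd => h C hC (hd.mono_right hST)

theorem exists_adj_of_induce_connected {C P : Set V} (hC : (G.induce C).Connected)
    (hP : ∃ x ∈ P, x ∈ C) (hPC : ∃ x ∈ C, x ∉ P) : ∃ y ∈ P, ∃ x ∈ C, y ∈ C ∧ x ∉ P ∧ G.Adj y x := by
  obtain ⟨x, hx, hxC⟩ := hP
  obtain ⟨y, hyC, hy⟩ := hPC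
  obtain ⟨p⟩ := hC.preconnected ⟨x, hxC⟩ ⟨y, hyC⟩
  obtain ⟨d, -, h1, h2⟩ := p.exists_boundary_dart {z | (z : V) ∈ P} hx hy
  exact ⟨d.fst, h1, d.snd, d.snd.2, d.fst.2, h2, d.adj⟩

theorem induce_insert_connected {C : Set V} {x y : V} (hC : (G.induce C).Connected)
    (hy : y ∈ C) (h : G.Adj y x) : (G.induce (insert x C)).Connected := by
  have := connected_induce_union hC.preconnected (t := {x}) (w := x) (by
    have : Subsingleton ({x} : Set V) := inferInstance
    exact fun a b => (Subsingleton.elim a b) ▸ Reachable.refl a) hy rfl h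
  rwa [Set.union_singleton] at this

/-- Distinctness of the six vertices need not be assumed: distinct vertices of `P_6` have distinct
neighbourhoods, so the adjacency pattern alone forces injectivity. -/
theorem induced_path_six_false {t : ℕ} (hG : G.IsPathBicliqueFree 6 t) {a b c d e f : V}
    (ab : G.Adj a b) (bc : G.Adj b c) (cd : G.Adj c d) (de : G.Adj d e) (ef : G.Adj e f)
    (ac : ¬ G.Adj a c) (ad : ¬ G.Adj a d) (ae : ¬ G.Adj a e) (af : ¬ G.Adj a f)
    (bd : ¬ G.Adj b d) (be : ¬ G.Adj b e) (bf : ¬ G.Adj b f)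
    (ce : ¬ G.Adj c e) (cf : ¬ G.Adj c f) (df : ¬ G.Adj d f) : False := by
  have key : ∀ i j : Fin 6, G.Adj (![a, b, c, d, e, f] i) (![a, b, c, d, e, f] j) ↔
      (i.val + 1 = j.val ∨ j.val + 1 = i.val) := by
    intro i j
    have := ab.symm; have := bc.symm; have := cd.symm; have := de.symm; have := ef.symm
    have ca := mt G.adj_symm ac
    have da := mt G.adj_symm ad
    have ea := mt G.adj_symm ae
    have fa := mt G.adj_symm af
    have db := mt G.adj_symm bd
    have eb := mt G.adj_symm be
    have fb := mt G.adj_symm bf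
    have ec := mt G.adj_symm ce
    have fc := mt G.adj_symm cf
    have fd := mt G.adj_symm df
    fin_cases i <;> fin_cases j <;> simp [*]
  have inj : ∀ i j : Fin 6, (∀ k : Fin 6, (i.val + 1 = k.val ∨ k.val + 1 = i.val) ↔
      (j.val + 1 = k.val ∨ k.val + 1 = j.val)) → i = j := by decide
  refine hG.1 ⟨⟨⟨![a, b, c, d, e, f], fun i j h => inj i j fun k => ?_⟩, ?_⟩⟩
  · rw [← key, ← key, h]
  · intro i j
    rw [pathGraph_adj]
    exact key i j

/-- An independent set of `t` common neighbours would form an induced `K_{2,t}` with `x` and `y`.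
This is the only way in which the biclique is used. -/
theorem indepNumOn_common_le [Finite V] {r t : ℕ} (ht : 1 ≤ t) (hG : G.IsPathBicliqueFree r t) {x y : V}
    (hne : x ≠ y) (hxy : ¬ G.Adj x y) {X : Set V} (h : ∀ v ∈ X, G.Adj x v ∧ G.Adj y v) :
    G.indepNumOn X ≤ t - 1 := by
  refine indepNumOn_le_iff.2 fun s hs hi => ?_
  by_contra hcard
  have e : Fin t ↪ s := (Function.Embedding.nonempty_of_card_le (by simp; omega)).some
  have hx : ∀ i, G.Adj x (e i) := fun i => (h _ (hs (e i).2)).1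
  have hy : ∀ i, G.Adj y (e i) := fun i => (h _ (hs (e i).2)).2
  have he : ∀ i j, ¬ G.Adj (e i) (e j) := fun i j hij => hi (e i).2 (e j).2 hij.ne hij
  refine hG.2 ⟨⟨⟨Sum.elim ![x, y] (fun i => (e i : V)), ?_⟩, ?_⟩⟩
  · rintro (i | i) (j | j) hij
    · fin_cases i <;> fin_cases j <;> simp_all [eq_comm]
    · have h1 := hx j; have h2 := hy j
      fin_cases i <;> simp at hij <;> simp [hij] at h1 h2
    · have h1 := hx i; have h2 := hy i
      fin_cases j <;> simp at hij <;> simp [hij] at h1 h2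
    · simpa [Subtype.ext_iff] using hij
  · have hyx : ¬ G.Adj y x := fun h => hxy h.symm
    intro i j
    change G.Adj (Sum.elim ![x, y] (fun i => (e i : V)) i)
      (Sum.elim ![x, y] (fun i => (e i : V)) j) ↔ _
    rcases i with i | i <;> rcases j with j | j
    · fin_cases i <;> fin_cases j <;> simp [hxy, hyx]
    · fin_cases i <;> simp [hx, hy]
    · fin_cases j <;> simp [(hx i).symm, (hy i).symm]
    · simp [he]

end Basics
end SimpleGraph

/-! ### Separating the neighbourhoods of two nonadjacent vertices. -/

namespace SimpleGraph
section TwoCentres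
variable {V : Type u} {G : SimpleGraph V}

/-- Explore `C` in layers from the neighbours of `u`. The hypotheses keep every neighbour of `v` out
of the first three layers. If one lies in the fourth layer, a shortest route gives an induced `P_6`
from `u` to `v`; if not, connectedness provides a fifth layer, and a shortest route from `u` into it
is an induced `P_6`. -/
theorem neighborhoods_linked {t : ℕ} (hG : G.IsPathBicliqueFree 6 t) {u v : V} (huv : ¬ G.Adj u v)
    {C : Set V} (hC : (G.induce C).Connected) (hu : ∃ x ∈ C, G.Adj u x) (hv : ∃ x ∈ C, G.Adj v x)
    (h0 : ∀ x ∈ C, G.Adj u x → ¬ G.Adj v x)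
    (h1 : ∀ a ∈ C, ∀ b ∈ C, G.Adj u a → G.Adj v b → ¬ G.Adj a b)
    (h2 : ∀ a ∈ C, ∀ r ∈ C, ∀ b ∈ C, G.Adj u a → G.Adj v b → G.Adj a r → G.Adj r b →
      ¬ G.Adj u r → ¬ G.Adj v r → False) : False := by
  obtain ⟨x, hxC, hux⟩ := hu
  obtain ⟨b, hbC, hvb⟩ := hv
  -- Closed neighbourhood within `C`; iterating it on `A0` gives the balls around the neighbours of
  -- `u`.
  set N : Set V → Set V := fun S => {x | x ∈ C ∧ (x ∈ S ∨ ∃ y ∈ S, G.Adj y x)} with hN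
  have hN1 : ∀ {S : Set V} {y z}, y ∈ S → z ∈ C → G.Adj y z → z ∈ N S :=
    fun hy hz h => ⟨hz, Or.inr ⟨_, hy, h⟩⟩
  have hN2 : ∀ {S : Set V} {z}, z ∈ S → z ∈ C → z ∈ N S := fun hy hz => ⟨hz, Or.inl hy⟩
  have hN3 : ∀ {S : Set V} {z}, z ∈ N S → z ∉ S → z ∈ C ∧ ∃ y ∈ S, G.Adj y z :=
    fun h h' => ⟨h.1, h.2.resolve_left h'⟩
  set A0 : Set V := {x | x ∈ C ∧ G.Adj u x} with hA0
  have hb0 : b ∉ A0 := fun h => h0 b hbC h.2 hvb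
  have hb1 : b ∉ N A0 := fun h => by
    obtain ⟨-, y, hy, hyb⟩ := hN3 h hb0
    exact h1 y hy.1 b hbC hy.2 hvb hyb
  have hb2 : b ∉ N (N A0) := fun h => by
    obtain ⟨-, r, hr, hrb⟩ := hN3 h hb1
    have hr0 : r ∉ A0 := fun h => hb1 (hN1 h hbC hrb)
    obtain ⟨hrC, a, ha, har⟩ := hN3 hr hr0
    exact h2 a ha.1 r hrC b hbC ha.2 hvb har hrb (fun h => hr0 ⟨hrC, h⟩)
      (fun h => h1 a ha.1 r hrC ha.2 h har)
  have chain : ∀ y, y ∈ N (N (N A0)) → y ∉ N (N A0) → ∃ a r s, a ∈ C ∧ r ∈ C ∧ s ∈ C ∧ G.Adj u a ∧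
      G.Adj a r ∧ G.Adj r s ∧ G.Adj s y ∧ ¬ G.Adj u r ∧ ¬ G.Adj u s ∧ ¬ G.Adj u y ∧ ¬ G.Adj a s ∧
      ¬ G.Adj a y ∧ ¬ G.Adj r y ∧ a ∈ A0 ∧ r ∈ N A0 ∧ s ∈ N (N A0) := by
    intro y hy hy2
    obtain ⟨hyC, s, hs, hsy⟩ := hN3 hy hy2
    have hs1 : s ∉ N A0 := fun h => hy2 (hN1 h hyC hsy)
    obtain ⟨hsC, r, hr, hrs⟩ := hN3 hs hs1
    have hr0 : r ∉ A0 := fun h => hs1 (hN1 h hsC hrs)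
    obtain ⟨hrC, a, ha, har⟩ := hN3 hr hr0
    exact ⟨a, r, s, ha.1, hrC, hsC, ha.2, har, hrs, hsy, fun h => hr0 ⟨hrC, h⟩,
      fun h => hs1 (hN2 ⟨hsC, h⟩ hsC), fun h => hy2 (hN2 (hN2 ⟨hyC, h⟩ hyC) hyC),
      fun h => hs1 (hN1 ha hsC h), fun h => hy2 (hN2 (hN1 ha hyC h) hyC),
      fun h => hy2 (hN1 hr hyC h), ha, hr, hs⟩
  by_cases hb3 : b ∈ N (N (N A0))
  · obtain ⟨a, r, s, haC, hrC, hsC, ua, ar, rs, sy, ur, us, uy, as, ay, ry, -, -, -⟩ := chain b hb3 hb2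
    have vr : ¬ G.Adj v r := fun h => h1 a haC r hrC ua h ar
    have vs : ¬ G.Adj v s := fun h => h2 a haC r hrC s hsC ua h ar rs ur vr
    exact induced_path_six_false hG ua ar rs sy hvb.symm ur us uy huv as ay
      (fun h => h0 a haC ua h.symm) ry (fun h => vr h.symm) (fun h => vs h.symm)
  · obtain ⟨y, hy, z, hzC, hyC, hz, hyz⟩ := exists_adj_of_induce_connected hC (P := N (N (N A0)))
      ⟨x, hN2 (hN2 (hN2 ⟨hxC, hux⟩ hxC) hxC) hxC, hxC⟩ ⟨b, hbC, hb3⟩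
    have hy2 : y ∉ N (N A0) := fun h => hz (hN1 h hzC hyz)
    obtain ⟨a, r, s, haC, hrC, hsC, ua, ar, rs, sy, ur, us, uy, as, ay, ry, ha, hr, hs⟩ := chain y hy hy2
    exact induced_path_six_false hG ua ar rs sy hyz ur us uy
      (fun h => hz (hN2 (hN2 (hN2 ⟨hzC, h⟩ hzC) hzC) hzC)) as ay
      (fun h => hz (hN2 (hN2 (hN1 ha hzC h) hzC) hzC)) ry
      (fun h => hz (hN2 (hN1 hr hzC h) hzC)) (fun h => hz (hN1 hs hzC h))

/-- If every vertex of `B` is adjacent to all of `A` up to a set of small independence number, then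
`A` has small independence number or `B` is a clique. -/
theorem indepNumOn_le_or_isClique [Finite V] {t m : ℕ} (ht : 1 ≤ t) (hG : G.IsPathBicliqueFree 6 t)
    {A B : Set V}
    (h : ∀ a ∈ B, G.indepNumOn {x ∈ A | x ≠ a ∧ ¬ G.Adj a x} ≤ m) :
    G.indepNumOn A ≤ 2 * m + (t - 1) ∨ G.IsClique B := by
  by_contra! hcon
  obtain ⟨h1, h2⟩ := hcon
  obtain ⟨a, ha, b, hb, hab, hadj⟩ := two_of_not_isClique h2
  have hsub : A ⊆ ({x ∈ A | x ≠ a ∧ ¬ G.Adj a x} ∪ {x ∈ A | x ≠ b ∧ ¬ G.Adj b x}) ∪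
      {x | G.Adj a x ∧ G.Adj b x} := by
    intro x hx
    by_cases hxa : x = a
    · subst hxa
      exact Or.inl (Or.inr ⟨hx, hab, fun h => hadj h.symm⟩)
    by_cases hxb : x = b
    · subst hxb
      exact Or.inl (Or.inl ⟨hx, hxa, hadj⟩)
    by_cases h1 : G.Adj a x
    · by_cases h2 : G.Adj b x
      · exact Or.inr ⟨h1, h2⟩
      · exact Or.inl (Or.inr ⟨hx, hxb, h2⟩)
    · exact Or.inl (Or.inl ⟨hx, hxa, h1⟩)
  have e1 := indepNumOn_mono (G := G) hsub
  have e2 := indepNumOn_union_le (G := G) ({x ∈ A | x ≠ a ∧ ¬ G.Adj a x} ∪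
    {x ∈ A | x ≠ b ∧ ¬ G.Adj b x}) {x | G.Adj a x ∧ G.Adj b x}
  have e3 := indepNumOn_union_le (G := G) {x ∈ A | x ≠ a ∧ ¬ G.Adj a x} {x ∈ A | x ≠ b ∧ ¬ G.Adj b x}
  have e4 := indepNumOn_common_le ht hG hab hadj (X := {x | G.Adj a x ∧ G.Adj b x}) fun v hv => hv
  have e5 := h a ha
  have e6 := h b hb
  omega

/-- Two nonadjacent vertices have a separator of small independence number. -/
theorem exists_separator_of_not_adj [Finite V] {t : ℕ} (ht : 2 ≤ t) (hG : G.IsPathBicliqueFree 6 t)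
    {u v : V} (hne : u ≠ v) (huv : ¬ G.Adj u v) :
    ∃ S : Set V, G.indepNumOn S ≤ 6 * (t - 1) + 2 ∧
      ∀ C : Set V, (G.induce C).Connected → Disjoint C S →
        Disjoint C (G.closedNbhd {u}) ∨ Disjoint C (G.closedNbhd {v}) := by
  have ht1 : 1 ≤ t := by omega
  have hvu : ¬ G.Adj v u := fun h => huv h.symm
  set W : Set V := {x | G.Adj u x ∧ G.Adj v x} with hW
  set A : Set V := {x | G.Adj u x ∧ ¬ G.Adj v x} with hA
  set B : Set V := {x | G.Adj v x ∧ ¬ G.Adj u x} with hB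
  have hWα : G.indepNumOn W ≤ t - 1 := indepNumOn_common_le ht1 hG hne huv fun x hx => hx
  have hS0 : G.indepNumOn (W ∪ ({u} ∪ {v})) ≤ (t - 1) + 2 := by
    have := indepNumOn_union_le (G := G) W ({u} ∪ {v})
    have := indepNumOn_union_le (G := G) {u} {v}
    have := indepNumOn_singleton_le (G := G) u
    have := indepNumOn_singleton_le (G := G) v
    omega
  -- deleting one of the two private neighbourhoods entirely
  have finA : ∀ X : Set V, (∀ x ∈ A, x ∈ X) → ∀ C : Set V, Disjoint C ((W ∪ ({u} ∪ {v})) ∪ X) →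
      Disjoint C (G.closedNbhd {u}) := by
    intro X hX C hd
    rw [Set.disjoint_left] at hd ⊢
    rintro x hx ⟨y, rfl, rfl | hy⟩
    · exact hd hx (by simp)
    · by_cases hxv : G.Adj v x
      · exact hd hx (Or.inl (Or.inl ⟨hy, hxv⟩))
      · exact hd hx (Or.inr (hX x ⟨hy, hxv⟩))
  have finB : ∀ X : Set V, (∀ x ∈ B, x ∈ X) → ∀ C : Set V, Disjoint C ((W ∪ ({u} ∪ {v})) ∪ X) →
      Disjoint C (G.closedNbhd {v}) := by
    intro X hX C hd
    rw [Set.disjoint_left] at hd ⊢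
    rintro x hx ⟨y, rfl, rfl | hy⟩
    · exact hd hx (by simp)
    · by_cases hxv : G.Adj u x
      · exact hd hx (Or.inl (Or.inl ⟨hxv, hy⟩))
      · exact hd hx (Or.inr (hX x ⟨hy, hxv⟩))
  -- Good vertices miss only a small part of their own side. The threshold `2(t-1)` lets a bad
  -- vertex lose `t-1` to common neighbours and still keep `t`; if the good vertices of one side are
  -- not a clique, that whole side has independence number at most `5(t-1)` and is deleted.
  set Ag : Set V := {a ∈ A | G.indepNumOn {x ∈ A | x ≠ a ∧ ¬ G.Adj a x} ≤ 2 * (t - 1)} with hAg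
  set Bg : Set V := {a ∈ B | G.indepNumOn {x ∈ B | x ≠ a ∧ ¬ G.Adj a x} ≤ 2 * (t - 1)} with hBg
  rcases indepNumOn_le_or_isClique ht1 hG (A := A) (B := Ag) (fun x hx => hx.2)
    with h | hAgc
  · refine ⟨(W ∪ ({u} ∪ {v})) ∪ A, ?_, fun C _ hd => Or.inl (finA A (fun _ h => h) C hd)⟩
    have := indepNumOn_union_le (G := G) (W ∪ ({u} ∪ {v})) A
    omega
  rcases indepNumOn_le_or_isClique ht1 hG (A := B) (B := Bg) (fun x hx => hx.2)
    with h | hBgc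
  · refine ⟨(W ∪ ({u} ∪ {v})) ∪ B, ?_, fun C _ hd => Or.inr (finB B (fun _ h => h) C hd)⟩
    have := indepNumOn_union_le (G := G) (W ∪ ({u} ∪ {v})) B
    omega
  have hAgα := indepNumOn_le_one_of_isClique hAgc
  have hBgα := indepNumOn_le_one_of_isClique hBgc
  have hgα := indepNumOn_union_le (G := G) Ag Bg
  -- every edge between the private neighbourhoods has a good end
  have hedge : ∀ a ∈ A, ∀ b ∈ B, G.Adj a b → a ∈ Ag ∨ b ∈ Bg := by
    intro a ha b hb hab
    by_contra! hcon
    obtain ⟨h1, h2⟩ := hcon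
    replace h1 : 2 * (t - 1) < G.indepNumOn {x ∈ A | x ≠ a ∧ ¬ G.Adj a x} := by
      by_contra! h; exact h1 ⟨ha, h⟩
    replace h2 : 2 * (t - 1) < G.indepNumOn {x ∈ B | x ≠ b ∧ ¬ G.Adj b x} := by
      by_contra! h; exact h2 ⟨hb, h⟩
    set P : Set V := {x ∈ A | x ≠ a ∧ ¬ G.Adj a x ∧ ¬ G.Adj b x} with hP
    set Q : Set V := {x ∈ B | x ≠ b ∧ ¬ G.Adj b x ∧ ¬ G.Adj a x} with hQ
    have eP : t ≤ G.indepNumOn P := by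
      have e1 : {x ∈ A | x ≠ a ∧ ¬ G.Adj a x} ⊆ P ∪ {x | G.Adj u x ∧ G.Adj b x} := by
        rintro x ⟨hx, h3, h4⟩
        by_cases h5 : G.Adj b x
        · exact Or.inr ⟨hx.1, h5⟩
        · exact Or.inl ⟨hx, h3, h4, h5⟩
      have e2 := indepNumOn_mono (G := G) e1
      have e3 := indepNumOn_union_le (G := G) P {x | G.Adj u x ∧ G.Adj b x}
      have e4 := indepNumOn_common_le ht1 hG (x := u) (y := b) (fun h => huv (h ▸ hb.1.symm)) hb.2
        (X := {x | G.Adj u x ∧ G.Adj b x}) fun x hx => hx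
      omega
    have eQ : t ≤ G.indepNumOn Q := by
      have e1 : {x ∈ B | x ≠ b ∧ ¬ G.Adj b x} ⊆ Q ∪ {x | G.Adj v x ∧ G.Adj a x} := by
        rintro x ⟨hx, h3, h4⟩
        by_cases h5 : G.Adj a x
        · exact Or.inr ⟨hx.1, h5⟩
        · exact Or.inl ⟨hx, h3, h4, h5⟩
      have e2 := indepNumOn_mono (G := G) e1
      have e3 := indepNumOn_union_le (G := G) Q {x | G.Adj v x ∧ G.Adj a x}
      have e4 := indepNumOn_common_le ht1 hG (x := v) (y := a) (fun h => hvu (h ▸ ha.1.symm)) ha.2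
        (X := {x | G.Adj v x ∧ G.Adj a x}) fun x hx => hx
      omega
    -- Otherwise `p u a b v q` is an induced `P_6`. Complete adjacency between `P` and `Q`, both of
    -- independence number at least `t`, then contradicts `K_{2,t}`-freeness.
    have hPQ : ∀ p ∈ P, ∀ q ∈ Q, G.Adj p q := by
      rintro p ⟨hpA, -, h3, h4⟩ q ⟨hqB, -, h5, h6⟩
      by_contra hpq
      exact induced_path_six_false hG hpA.1.symm ha.1 hab hb.1.symm hqB.1
        (fun h => h3 h.symm) (fun h => h4 h.symm) (fun h => hpA.2 h.symm) hpq
        hb.2 huv hqB.2 (fun h => ha.2 h.symm) h6 h5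
    have hPc : ¬ G.IsClique P := fun h => by
      have := indepNumOn_le_one_of_isClique h
      omega
    obtain ⟨p, hp, p', hp', hne', hadj'⟩ := two_of_not_isClique hPc
    have := indepNumOn_common_le ht1 hG hne' hadj' (X := Q)
      fun q hq => ⟨hPQ p hp q hq, hPQ p' hp' q hq⟩
    omega
  set A1 : Set V := {a ∈ A | a ∉ Ag} with hA1
  set B1 : Set V := {b ∈ B | b ∉ Bg} with hB1
  have hanti : ∀ a ∈ A1, ∀ b ∈ B1, ¬ G.Adj a b := fun a ha b hb hab =>
    (hedge a ha.1 b hb.1 hab).elim ha.2 hb.2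
  -- The remaining private neighbourhoods are anticomplete; `A2` consists of the ends in `A1` of the
  -- two-edge links to `B1`, the last obstruction to `neighborhoods_linked`.
  set A2 : Set V := {a ∈ A1 | ∃ r, ∃ b ∈ B1, G.Adj a r ∧ G.Adj r b ∧ ¬ G.Adj u r ∧ ¬ G.Adj v r}
    with hA2
  have hA2α : ∀ a ∈ A2, G.indepNumOn {x ∈ A1 | x ≠ a ∧ ¬ G.Adj a x} ≤ t - 1 := by
    rintro a ⟨ha, r, b, hb, har, hrb, hur, hvr⟩
    refine indepNumOn_common_le ht1 hG (x := u) (y := r) (fun h => hb.1.2 (h ▸ hrb)) hur ?_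
    rintro x ⟨hx, -, hax⟩
    refine ⟨hx.1.1, ?_⟩
    -- If `r` missed `x`, then `x u a r b v` would be an induced `P_6`; so the non-neighbours of `a`
    -- in `A1` are common neighbours of `u` and `r`.
    by_contra hrx
    exact induced_path_six_false hG hx.1.1.symm ha.1.1 har hrb hb.1.1.symm (fun h => hax h.symm)
      (fun h => hrx h.symm) (hanti x hx b hb) (fun h => hx.1.2 h.symm) hur hb.1.2 huv
      (hanti a ha b hb) (fun h => ha.1.2 h.symm) (fun h => hvr h.symm)
  rcases indepNumOn_le_or_isClique ht1 hG (A := A1) (B := A2) hA2α with h | hA2c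
  · refine ⟨(W ∪ ({u} ∪ {v})) ∪ ((Ag ∪ Bg) ∪ A1), ?_, fun C _ hd => Or.inl (finA _ ?_ C hd)⟩
    · have := indepNumOn_union_le (G := G) (W ∪ ({u} ∪ {v})) ((Ag ∪ Bg) ∪ A1)
      have := indepNumOn_union_le (G := G) (Ag ∪ Bg) A1
      omega
    · intro x hx
      by_cases hxg : x ∈ Ag
      · exact Or.inl (Or.inl hxg)
      · exact Or.inr ⟨hx, hxg⟩
  · refine ⟨(W ∪ ({u} ∪ {v})) ∪ ((Ag ∪ Bg) ∪ A2), ?_, fun C hC hd => ?_⟩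
    · have := indepNumOn_union_le (G := G) (W ∪ ({u} ∪ {v})) ((Ag ∪ Bg) ∪ A2)
      have := indepNumOn_union_le (G := G) (Ag ∪ Bg) A2
      have := indepNumOn_le_one_of_isClique hA2c
      omega
    · by_contra! hcon
      obtain ⟨hcu, hcv⟩ := hcon
      rw [Set.disjoint_left] at hd
      rw [Set.not_disjoint_iff] at hcu hcv
      obtain ⟨x, hxC, u', rfl, hx⟩ := hcu
      obtain ⟨y, hyC, v', rfl, hy⟩ := hcv
      have hx' : G.Adj u' x := hx.resolve_left fun h => hd hxC (h ▸ by simp)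
      have hy' : G.Adj v' y := hy.resolve_left fun h => hd hyC (h ▸ by simp)
      have h0 : ∀ x ∈ C, G.Adj u' x → ¬ G.Adj v' x :=
        fun x hx h1 h2 => hd hx (Or.inl (Or.inl ⟨h1, h2⟩))
      have hCA : ∀ x ∈ C, G.Adj u' x → x ∈ A1 := fun x hx h =>
        ⟨⟨h, h0 x hx h⟩, fun h' => hd hx (Or.inr (Or.inl (Or.inl h')))⟩
      have hCB : ∀ x ∈ C, G.Adj v' x → x ∈ B1 := fun x hx h =>
        ⟨⟨h, fun h' => h0 x hx h' h⟩, fun h' => hd hx (Or.inr (Or.inl (Or.inr h')))⟩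
      refine neighborhoods_linked hG huv hC ⟨x, hxC, hx'⟩ ⟨y, hyC, hy'⟩ h0
        (fun a ha b hb h1 h2 => hanti a (hCA a ha h1) b (hCB b hb h2)) ?_
      intro a ha r _ b hb h1 h2 h3 h4 h5 h6
      exact hd ha (Or.inr (Or.inr ⟨hCA a ha h1, r, b, hCB b hb h2, h3, h4, h5, h6⟩))

end TwoCentres
end SimpleGraph

/-! ### Heavy connected sets, trading neighbourhoods, and the Gyárfás path. -/

namespace SimpleGraph
section Weights
variable {V : Type u} {G : SimpleGraph V}

theorem setWeight_mono [Fintype V] (w : V → ℝ≥0) {X Y : Set V} (h : X ⊆ Y) :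
    setWeight w X ≤ setWeight w Y :=
  Finset.sum_le_sum fun _ _ => Set.indicator_le_indicator_of_subset h (fun _ => zero_le) _

theorem setWeight_union_of_disjoint [Fintype V] (w : V → ℝ≥0) {X Y : Set V} (h : Disjoint X Y) :
    setWeight w (X ∪ Y) = setWeight w X + setWeight w Y := by
  unfold setWeight
  rw [← Finset.sum_add_distrib]
  exact Finset.sum_congr rfl fun v _ => by rw [Set.indicator_union_of_disjoint h]

theorem inter_nonempty_of_heavy [Fintype V] {w : V → ℝ≥0} {X Y : Set V}
    (hX : 7 * setWeight w Set.univ < 8 * setWeight w X)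
    (hY : 7 * setWeight w Set.univ < 8 * setWeight w Y) : (X ∩ Y).Nonempty := by
  by_contra h
  have hd : Disjoint X Y := Set.disjoint_iff_inter_eq_empty.2 (Set.not_nonempty_iff_eq_empty.1 h)
  have h1 := setWeight_mono w (Set.subset_univ (X ∪ Y))
  rw [setWeight_union_of_disjoint w hd] at h1
  rw [← NNReal.coe_lt_coe] at hX hY
  rw [← NNReal.coe_le_coe] at h1
  push_cast at hX hY h1
  have := (setWeight w Set.univ).2
  have := (setWeight w X).2
  simp only [NNReal.val_eq_coe] at *
  linarith

theorem setWeight_subtype [Fintype V] (w : V → ℝ≥0) (B : Set V) [Fintype B] (X : Set B) :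
    setWeight (fun v : B => w v) X = setWeight w (Subtype.val '' X) := by
  refine Fintype.sum_of_injective Subtype.val Subtype.val_injective _ _ (fun v hv => ?_) fun v => ?_
  · refine Set.indicator_of_notMem ?_ _
    rintro ⟨y, -, rfl⟩
    exact hv ⟨y, rfl⟩
  · by_cases h : v ∈ X <;> simp [Set.indicator, h]

theorem IsPathBicliqueFree.induce {r t : ℕ} (hG : G.IsPathBicliqueFree r t) (B : Set V) :
    (G.induce B).IsPathBicliqueFree r t :=
  ⟨fun ⟨f⟩ => hG.1 ⟨(Embedding.induce B).comp f⟩, fun ⟨f⟩ => hG.2 ⟨(Embedding.induce B).comp f⟩⟩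

theorem induce_preimage_connected {B C : Set V} (hCB : C ⊆ B) (hC : (G.induce C).Connected) :
    ((G.induce B).induce (Subtype.val ⁻¹' C)).Connected := by
  let e : (G.induce B).induce (Subtype.val ⁻¹' C) ≃g G.induce C :=
    { toFun := fun x => ⟨x.1.1, x.2⟩
      invFun := fun x => ⟨⟨x.1, hCB x.2⟩, x.2⟩
      left_inv := fun _ => rfl
      right_inv := fun _ => rfl
      map_rel_iff' := Iff.rfl }
  exact e.connected_iff.2 hC

theorem indepNumOn_image_val_le [Finite V] (B : Set V) (Z : Set B) :
    G.indepNumOn (Subtype.val '' Z) ≤ (G.induce B).indepNumOn Z := by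
  classical
  refine indepNumOn_le_iff.2 fun s hs hi => ?_
  have : (s.subtype (· ∈ B)).card = s.card := by
    rw [Finset.card_subtype, Finset.filter_true_of_mem]
    intro x hx
    obtain ⟨y, -, rfl⟩ := hs hx
    exact y.2
  rw [← this]
  refine card_le_indepNumOn ?_ ?_
  · intro x hx
    rw [Finset.mem_coe, Finset.mem_subtype] at hx
    obtain ⟨y, hy, hyx⟩ := hs hx
    rwa [← Subtype.ext hyx]
  · intro a ha b hb hab
    rw [Finset.mem_coe, Finset.mem_subtype] at ha hb
    exact hi ha hb fun h => hab (Subtype.ext h)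

/-- Every weighting of a connected `{P_6, K_{2,t}}`-free graph has a light separator consisting of
the closed neighbourhoods of at most `k` vertices and a set of independence number at most `m`. -/
def HasNbhdSeparators (k m t : ℕ) : Prop :=
  ∀ (V : Type u) [Fintype V] (G : SimpleGraph V), G.Connected → G.IsPathBicliqueFree 6 t →
    ∀ w : V → ℝ≥0, ∃ X : Finset V, X.card ≤ k ∧ ∃ Z : Set V, G.indepNumOn Z ≤ m ∧
      G.IsLightSeparator w (G.closedNbhd X ∪ Z)

/-- A light separator of a heavy component of `G - K` is, together with `K`, light in `G`. -/
theorem isLightSeparator_of_induce [Fintype V] {w : V → ℝ≥0} {K B : Set V} [Fintype B]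
    (hB : Maximal (fun C : Set V => (G.induce C).Connected ∧ Disjoint C K) B)
    (hBw : 7 * setWeight w Set.univ < 8 * setWeight w B) {X : Finset B} {Z : Set B}
    (h : (G.induce B).IsLightSeparator (fun v => w v) ((G.induce B).closedNbhd X ∪ Z)) :
    G.IsLightSeparator w (G.closedNbhd (X.map (Function.Embedding.subtype _) : Finset V) ∪
      Subtype.val '' Z ∪ K) := by
  intro C hC hd
  by_contra! hCw
  have hCK : Disjoint C K := hd.mono_right Set.subset_union_right
  have hCB : C ⊆ B := Set.union_subset_iff.1 (hB.2 (y := B ∪ C) ⟨induce_union_connected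
    hB.1.1.preconnected hC.preconnected (inter_nonempty_of_heavy hBw hCw),
    Set.disjoint_union_left.2 ⟨hB.1.2, hCK⟩⟩ Set.subset_union_left) |>.2
  have := h _ (induce_preimage_connected hCB hC) (by
    rw [Set.disjoint_left] at hd ⊢
    rintro x hx (⟨y, hy, h⟩ | h)
    · refine hd hx (Or.inl (Or.inl ⟨y, by simpa using hy, ?_⟩))
      rcases h with h | h
      · exact Or.inl (congrArg _ h)
      · exact Or.inr h
    · exact hd hx (Or.inl (Or.inr ⟨x, h, rfl⟩)))
  rw [setWeight_subtype, setWeight_subtype, Subtype.image_preimage_coe,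
    Set.inter_eq_right.2 hCB] at this
  have h1 := setWeight_mono w (Set.subset_univ ((Subtype.val '' (Set.univ : Set B))))
  exact absurd (this.trans (mul_le_mul_right h1 7)) (not_le.2 hCw)

theorem closedNbhd_subset_erase [DecidableEq V] (X : Finset V) (u : V) :
    G.closedNbhd X ⊆ G.closedNbhd (X.erase u : Finset V) ∪ G.closedNbhd {u} := by
  rintro v ⟨x, hx, h⟩
  by_cases hxu : x = u
  · exact Or.inr ⟨x, hxu, h⟩
  · exact Or.inl ⟨x, by simpa [hxu] using hx, h⟩

/-- Trading one closed neighbourhood for a set of bounded independence number. -/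
theorem HasNbhdSeparators.exists_of_succ {k m t : ℕ} (ht : 2 ≤ t)
    (h : HasNbhdSeparators.{u} (k + 1) m t) [Fintype V] (hG : G.IsPathBicliqueFree 6 t)
    (w : V → ℝ≥0) : ∃ X : Finset V, X.card ≤ k ∧ ∃ Z : Set V,
      G.indepNumOn Z ≤ 6 * (t - 1) + 3 + 2 * m ∧ G.IsLightSeparator w (G.closedNbhd X ∪ Z) := by
  classical
  -- A clique of centres: each member occurs among the centres of a separator that is light once `K`
  -- is deleted as well. Enlarging `K` preserves this for the old members.
  let good : Set V → Prop := fun K => G.IsClique K ∧ ∀ u ∈ K, ∃ X : Finset V, u ∈ X ∧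
    X.card ≤ k + 1 ∧ ∃ Z : Set V, G.indepNumOn Z ≤ m ∧
      G.IsLightSeparator w (G.closedNbhd X ∪ Z ∪ K)
  obtain ⟨K, -, hK⟩ := Finite.exists_le_maximal (p := good) (a := ∅) ⟨by simp, by simp⟩
  have hKα := indepNumOn_le_one_of_isClique hK.1.1
  by_cases hL : G.IsLightSeparator w K
  · exact ⟨∅, by simp, K, by omega, hL.mono Set.subset_union_right⟩
  obtain ⟨C, hC, hCK, hCw⟩ : ∃ C : Set V, (G.induce C).Connected ∧ Disjoint C K ∧
      7 * setWeight w Set.univ < 8 * setWeight w C := by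
    simpa [IsLightSeparator] using hL
  obtain ⟨B, hCB, hB⟩ := Finite.exists_le_maximal
    (p := fun C : Set V => (G.induce C).Connected ∧ Disjoint C K) ⟨hC, hCK⟩
  have hBw : 7 * setWeight w Set.univ < 8 * setWeight w B :=
    hCw.trans_le (mul_le_mul_right (setWeight_mono w hCB) 8)
  obtain ⟨X', hX', Z', hZ', hXZ⟩ := h B (G.induce B) hB.1.1 (hG.induce B) fun v => w v
  have hlight := isLightSeparator_of_induce hB hBw hXZ
  have hZα := (indepNumOn_image_val_le (G := G) B Z').trans hZ'
  set X : Finset V := X'.map (Function.Embedding.subtype _) with hX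
  set Z : Set V := Subtype.val '' Z' with hZ
  have hXcard : X.card ≤ k + 1 := by rwa [hX, Finset.card_map]
  rcases X.eq_empty_or_nonempty with hXe | ⟨x, hx⟩
  · refine ⟨∅, by simp, Z ∪ K, ?_, ?_⟩
    · have := indepNumOn_union_le (G := G) Z K
      omega
    · rw [hXe, Set.union_assoc] at hlight
      exact hlight
  have hsep : ∀ u ∈ K ∪ X, ∃ X : Finset V, u ∈ X ∧ X.card ≤ k + 1 ∧ ∃ Z : Set V,
      G.indepNumOn Z ≤ m ∧ G.IsLightSeparator w (G.closedNbhd X ∪ Z ∪ K) := by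
    rintro u (hu | hu)
    · exact hK.1.2 u hu
    · exact ⟨X, hu, hXcard, Z, hZα, hlight⟩
  -- Otherwise `K ∪ X` would be good, and maximality would put `X` inside `K`, although `X` lies in
  -- the component `B` of `G - K`.
  have hncl : ¬ G.IsClique (K ∪ X) := by
    intro hcl
    have hxK := hK.2 (y := K ∪ X) ⟨hcl, fun u hu => by
      obtain ⟨X, h1, h2, Z, h3, h4⟩ := hsep u hu
      exact ⟨X, h1, h2, Z, h3, h4.mono (Set.union_subset_union_right _ Set.subset_union_left)⟩⟩
      Set.subset_union_left (Or.inr hx)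
    have hxB : x ∈ B := by
      obtain ⟨y, -, rfl⟩ := Finset.mem_map.1 hx
      exact y.2
    exact Set.disjoint_left.1 hB.1.2 hxB hxK
  obtain ⟨u, hu, v, hv, huv, hadj⟩ := two_of_not_isClique hncl
  obtain ⟨S, hS, hSsep⟩ := exists_separator_of_not_adj ht hG huv hadj
  obtain ⟨Xu, hu1, hu2, Zu, hu3, hu4⟩ := hsep u hu
  obtain ⟨Xv, hv1, hv2, Zv, hv3, hv4⟩ := hsep v hv
  -- `S` contributes `6(t-1)+2`, the clique `K` one, and `Zu`, `Zv` at most `m` each.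
  have hα : G.indepNumOn ((S ∪ K) ∪ (Zu ∪ Zv)) ≤ 6 * (t - 1) + 3 + 2 * m := by
    have := indepNumOn_union_le (G := G) (S ∪ K) (Zu ∪ Zv)
    have := indepNumOn_union_le (G := G) S K
    have := indepNumOn_union_le (G := G) Zu Zv
    omega
  -- If a heavy `C` touched `N[u]` and a heavy `D` touched `N[v]`, then `C ∪ D` would be connected,
  -- avoid `S` and touch both.
  have hmiss : (∀ C : Set V, (G.induce C).Connected → Disjoint C ((S ∪ K) ∪ (Zu ∪ Zv)) →
        7 * setWeight w Set.univ < 8 * setWeight w C → Disjoint C (G.closedNbhd {u})) ∨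
      (∀ C : Set V, (G.induce C).Connected → Disjoint C ((S ∪ K) ∪ (Zu ∪ Zv)) →
        7 * setWeight w Set.univ < 8 * setWeight w C → Disjoint C (G.closedNbhd {v})) := by
    by_contra! hcon
    obtain ⟨⟨C, hC, hCS, hCw, hCu⟩, ⟨D, hD, hDS, hDw, hDv⟩⟩ := hcon
    rcases hSsep (C ∪ D) (induce_union_connected hC.preconnected hD.preconnected
      (inter_nonempty_of_heavy hCw hDw)) ((Set.disjoint_union_left.2 ⟨hCS, hDS⟩).mono_right
        (Set.subset_union_left.trans Set.subset_union_left)) with h | h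
    · exact hCu (h.mono_left Set.subset_union_left)
    · exact hDv (h.mono_left Set.subset_union_right)
  have main : ∀ (x : V) (Xx : Finset V) (Zx : Set V), x ∈ Xx → Xx.card ≤ k + 1 →
      Zx ⊆ (S ∪ K) ∪ (Zu ∪ Zv) → G.IsLightSeparator w (G.closedNbhd Xx ∪ Zx ∪ K) →
      (∀ C : Set V, (G.induce C).Connected → Disjoint C ((S ∪ K) ∪ (Zu ∪ Zv)) →
        7 * setWeight w Set.univ < 8 * setWeight w C → Disjoint C (G.closedNbhd {x})) →
      ∃ X : Finset V, X.card ≤ k ∧ ∃ Z : Set V, G.indepNumOn Z ≤ 6 * (t - 1) + 3 + 2 * m ∧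
        G.IsLightSeparator w (G.closedNbhd X ∪ Z) := by
    intro x Xx Zx hx1 hx2 hx3 hx4 hx5
    refine ⟨Xx.erase x, by rw [Finset.card_erase_of_mem hx1]; omega, _, hα, fun C hC hd => ?_⟩
    by_contra! hCw
    obtain ⟨hd1, hd2⟩ := Set.disjoint_union_right.1 hd
    have hd3 := hx5 C hC hd2 hCw
    refine absurd (hx4 C hC ?_) (not_le.2 hCw)
    refine Set.disjoint_union_right.2 ⟨Set.disjoint_union_right.2 ⟨?_, hd2.mono_right hx3⟩,
      hd2.mono_right (Set.subset_union_right.trans Set.subset_union_left)⟩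
    exact (Set.disjoint_union_right.2 ⟨hd1, hd3⟩).mono_right (closedNbhd_subset_erase Xx x)
  rcases hmiss with hmiss | hmiss
  · exact main u Xu Zu hu1 hu2 (Set.subset_union_left.trans Set.subset_union_right) hu4 hmiss
  · exact main v Xv Zv hv1 hv2 (Set.subset_union_right.trans Set.subset_union_right) hv4 hmiss

theorem HasNbhdSeparators.of_succ {k m t : ℕ} (ht : 2 ≤ t) (h : HasNbhdSeparators.{u} (k + 1) m t) :
    HasNbhdSeparators.{u} k (6 * (t - 1) + 3 + 2 * m) t :=
  fun _ _ _ _ hG w => h.exists_of_succ ht hG w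

/-- The Gyárfás path argument: either the closed neighbourhood of a small set is a light separator,
or there is an induced path ending at a heavy connected set. -/
theorem exists_inducedPath_of_not_isLightSeparator [Fintype V] (hG : G.Connected) {w : V → ℝ≥0} {k : ℕ}
    (h : ∀ X : Finset V, X.card ≤ k → ¬ G.IsLightSeparator w (G.closedNbhd X)) (n : ℕ) (hn : n ≤ k) :
    ∃ (f : ℕ → V) (D : Set V), (∀ i j, i < j → j ≤ n → (G.Adj (f i) (f j) ↔ j = i + 1)) ∧
      (G.induce D).Connected ∧ 7 * setWeight w Set.univ < 8 * setWeight w D ∧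
      Disjoint D (G.closedNbhd (f '' {i | i < n})) ∧ (G.induce (insert (f n) D)).Connected := by
  classical
  have heavy : ∀ X : Finset V, X.card ≤ k → ∃ C : Set V, (G.induce C).Connected ∧
      Disjoint C (G.closedNbhd X) ∧ 7 * setWeight w Set.univ < 8 * setWeight w C := by
    intro X hX
    simpa [IsLightSeparator] using h X hX
  induction n with
  | zero =>
    obtain ⟨C, hC, -, hCw⟩ := heavy ∅ (by simp)
    have huniv : (G.induce Set.univ).Connected := (induceUnivIso G).connected_iff.2 hG
    refine ⟨fun _ => hG.nonempty.some, Set.univ, by omega, huniv,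
      hCw.trans_le (mul_le_mul_right (setWeight_mono w (Set.subset_univ _)) 8), ?_, ?_⟩
    · simp [closedNbhd]
    · rwa [Set.insert_eq_of_mem (Set.mem_univ _)]
  | succ n ih =>
    obtain ⟨f, D, hf, hD, hDw, hDd, hDf⟩ := ih (by omega)
    obtain ⟨D', hD', hDd', hDw'⟩ := heavy ((Finset.range (n + 1)).image f)
      (Finset.card_image_le.trans (by simpa using hn))
    have himg : (((Finset.range (n + 1)).image f : Finset V) : Set V) = f '' {i | i < n + 1} := by
      ext; simp
    rw [himg] at hDd'
    have hU : (G.induce (insert (f n) D ∪ D')).Connected :=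
      induce_union_connected hDf.preconnected hD'.preconnected
        ((inter_nonempty_of_heavy hDw hDw').mono
          (Set.inter_subset_inter_left _ (Set.subset_insert _ _)))
    -- `P` is the component around `D'` after deleting the neighbourhoods of the path so far. A
    -- vertex `x` just outside `P` lies in `D`, hence misses the earlier path vertices, and so is
    -- adjacent to `f n`: it is the next path vertex.
    obtain ⟨P, hPD, hP⟩ := Finite.exists_le_maximal (p := fun P : Set V => (G.induce P).Connected ∧
      P ⊆ insert (f n) D ∪ D' ∧ Disjoint P (G.closedNbhd (f '' {i | i < n + 1})))
      ⟨hD', Set.subset_union_right, hDd'⟩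
    have hfn : f n ∉ P := fun h => Set.disjoint_left.1 hP.1.2.2 h
      ⟨f n, ⟨n, Nat.lt_succ_self n, rfl⟩, Or.inl rfl⟩
    obtain ⟨z, hz⟩ := hD'.nonempty
    obtain ⟨y, hy, x, hx, hyU, hxP, hyx⟩ := exists_adj_of_induce_connected hU (P := P)
      ⟨z, hPD hz, Or.inr hz⟩ ⟨f n, Or.inl (Set.mem_insert _ _), hfn⟩
    have hPx := induce_insert_connected hP.1.1 hy hyx
    have hxN : x ∈ G.closedNbhd (f '' {i | i < n + 1}) := by
      by_contra hxN
      refine hxP (hP.2 (y := insert x P) ⟨hPx, Set.insert_subset hx hP.1.2.1, ?_⟩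
        (Set.subset_insert _ _) (Set.mem_insert _ _))
      exact Set.disjoint_insert_left.2 ⟨hxN, hP.1.2.2⟩
    have hxf : x ≠ f n := by
      rintro rfl
      exact Set.disjoint_left.1 hP.1.2.2 hy ⟨f n, ⟨n, Nat.lt_succ_self n, rfl⟩, Or.inr hyx.symm⟩
    have hxD : x ∈ D := by
      rcases hx with (rfl | hx) | hx
      · exact absurd rfl hxf
      · exact hx
      · exact absurd (hPD hx) hxP
    have hxn : x ∉ G.closedNbhd (f '' {i | i < n}) := Set.disjoint_left.1 hDd hxD
    have hfx : G.Adj (f n) x := by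
      obtain ⟨_, ⟨i, hi, rfl⟩, h⟩ := hxN
      rcases (Nat.lt_succ_iff_lt_or_eq.1 hi) with hi | rfl
      · exact absurd ⟨f i, ⟨i, hi, rfl⟩, h⟩ hxn
      · exact h.resolve_left hxf
    have hupd : ∀ i, i < n + 1 → Function.update f (n + 1) x i = f i :=
      fun i hi => Function.update_of_ne hi.ne _ _
    have himg' : Function.update f (n + 1) x '' {i | i < n + 1} = f '' {i | i < n + 1} :=
      Set.image_congr fun i hi => hupd i hi
    refine ⟨Function.update f (n + 1) x, P, ?_, hP.1.1,
      hDw'.trans_le (mul_le_mul_right (setWeight_mono w hPD) 8), by rw [himg']; exact hP.1.2.2,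
      by rw [Function.update_self]; exact hPx⟩
    intro i j hij hj
    rw [hupd i (by omega)]
    rcases Nat.le_succ_iff_eq_or_le.1 hj with rfl | hj
    · rw [Function.update_self]
      constructor
      · intro hadj
        by_contra hne
        exact hxn ⟨f i, ⟨i, by simp; omega, rfl⟩, Or.inr hadj⟩
      · intro h
        obtain rfl : i = n := by omega
        exact hfx
    · rw [hupd j (by omega)]
      exact hf i j hij hj

theorem hasNbhdSeparators_five (t : ℕ) : HasNbhdSeparators.{u} 5 0 t := by
  intro V _ G hG hfree w
  by_contra! hcon
  obtain ⟨f, -, hf, -⟩ := exists_inducedPath_of_not_isLightSeparator hG (w := w) (k := 5)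
    (fun X hX h => hcon X hX ∅ indepNumOn_empty.le (by simpa using h)) 5 le_rfl
  refine induced_path_six_false hfree (a := f 0) (b := f 1) (c := f 2) (d := f 3) (e := f 4)
    (f := f 5) ?_ ?_ ?_ ?_ ?_ ?_ ?_ ?_ ?_ ?_ ?_ ?_ ?_ ?_ ?_ <;>
  first
  | exact (hf _ _ (by norm_num) (by norm_num)).2 rfl
  | exact mt (hf _ _ (by norm_num) (by norm_num)).1 (by norm_num)

end Weights
end SimpleGraph

/-! ### From light separators to tree-decompositions. -/

namespace SimpleGraph

/-- Every edge is a bridge: a walk avoiding it cannot leave its own summand, so it would already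
bypass the edge there. -/
theorem IsAcyclic.sum {α β : Type*} {G : SimpleGraph α} {H : SimpleGraph β} (hG : G.IsAcyclic)
    (hH : H.IsAcyclic) : (G ⊕g H).IsAcyclic := by
  rw [isAcyclic_iff_forall_adj_isBridge] at hG hH ⊢
  rintro (a | a) (b | b) hab
  · rw [isBridge_iff]
    rintro ⟨p⟩
    have hb := isBridge_iff.1 (hG (sum_adj_inl.1 hab))
    obtain ⟨d, -, ⟨y, hy, hay⟩, hd⟩ := p.exists_boundary_dart
      {z | ∃ y, z = Sum.inl y ∧ (G.deleteEdges {s(a, b)}).Reachable a y} ⟨a, rfl, Reachable.refl a⟩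
      (fun ⟨y, hy, h⟩ => hb (Sum.inl.inj hy ▸ h))
    have hadj := d.adj
    rw [deleteEdges_adj, hy] at hadj
    rcases hz : d.snd with z | z
    · rw [hz, sum_adj_inl] at hadj
      refine hd ⟨z, hz, hay.trans (Adj.reachable ?_)⟩
      rw [deleteEdges_adj]
      refine ⟨hadj.1, fun h => hadj.2 ?_⟩
      simpa using h
    · rw [hz] at hadj
      exact not_adj_sum_inl_inr _ _ hadj.1
  · exact absurd hab (not_adj_sum_inl_inr _ _)
  · exact absurd hab.symm (not_adj_sum_inl_inr _ _)
  · rw [isBridge_iff]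
    rintro ⟨p⟩
    have hb := isBridge_iff.1 (hH (sum_adj_inr.1 hab))
    obtain ⟨d, -, ⟨y, hy, hay⟩, hd⟩ := p.exists_boundary_dart
      {z | ∃ y, z = Sum.inr y ∧ (H.deleteEdges {s(a, b)}).Reachable a y} ⟨a, rfl, Reachable.refl a⟩
      (fun ⟨y, hy, h⟩ => hb (Sum.inr.inj hy ▸ h))
    have hadj := d.adj
    rw [deleteEdges_adj, hy] at hadj
    rcases hz : d.snd with z | z
    · rw [hz] at hadj
      exact not_adj_sum_inl_inr _ _ hadj.1.symm
    · rw [hz, sum_adj_inr] at hadj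
      refine hd ⟨z, hz, hay.trans (Adj.reachable ?_)⟩
      rw [deleteEdges_adj]
      refine ⟨hadj.1, fun h => hadj.2 ?_⟩
      simpa using h

theorem IsTree.sum_sup_edge {α β : Type*} {G : SimpleGraph α} {H : SimpleGraph β} (hG : G.IsTree)
    (hH : H.IsTree) (a : α) (b : β) : ((G ⊕g H) ⊔ edge (Sum.inl a) (Sum.inr b)).IsTree :=
  ⟨hG.1.sum_sup_edge hH.1,
    (hG.2.sum hH.2).sup_edge_of_not_reachable (not_reachable_sum_inl_inr _ _)⟩

section TreeDecompositions
variable {V : Type u} {G : SimpleGraph V}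

theorem induce_image_connected {α β : Type*} {T : SimpleGraph α} {T' : SimpleGraph β} (f : α ↪ β)
    (hf : ∀ a b, T.Adj a b → T'.Adj (f a) (f b)) {s : Set α} (hs : (T.induce s).Connected) :
    (T'.induce (f '' s)).Connected := by
  let φ : T.induce s →g T'.induce (f '' s) :=
    { toFun := fun x => ⟨f x, x, x.2, rfl⟩
      map_rel' := fun h => hf _ _ h }
  have : Function.Surjective φ := by
    rintro ⟨_, x, hx, rfl⟩
    exact ⟨⟨x, hx⟩, rfl⟩
  exact hs.map φ this

/-- The subgraph of `G` induced by `U` has a tree-decomposition whose bags have independence number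
at most `k`, and one of whose bags is `β`. -/
def HasTreeDecompositionOn (G : SimpleGraph V) (k : ℕ) (U β : Set V) : Prop :=
  ∃ (N : Type) (_ : Finite N) (T : SimpleGraph N) (s : V → Set N) (x : N), T.IsTree ∧
    (∀ v ∈ U, (T.induce (s v)).Connected) ∧ (∀ v, v ∉ U → s v = ∅) ∧
    (∀ u ∈ U, ∀ v ∈ U, G.Adj u v → (s u ∩ s v).Nonempty) ∧
    (∀ i, G.indepNumOn {v | i ∈ s v} ≤ k) ∧ {v | x ∈ s v} = β

theorem HasTreeDecompositionOn.single {k : ℕ} {U : Set V} (h : G.indepNumOn U ≤ k) :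
    G.HasTreeDecompositionOn k U U := by
  refine ⟨Unit, inferInstance, ⊥, fun v => {_x | v ∈ U}, (), IsTree.of_subsingleton, ?_, ?_, ?_, ?_, ?_⟩
  · intro v hv
    have : Nonempty {_x : Unit | v ∈ U} := ⟨⟨(), hv⟩⟩
    exact Connected.mk (fun a b => (Subsingleton.elim a b) ▸ Reachable.refl a)
  · intro v hv
    simp [hv]
  · intro u hu v hv _
    exact ⟨(), hu, hv⟩
  · intro _
    exact h
  · rfl

/-- Join the two trees by an edge between the marked nodes. Shared vertices lie in both marked bags,
so their two subtrees merge into one, and no bag changes. -/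
theorem HasTreeDecompositionOn.glue {k : ℕ} {U₁ U₂ β₁ β₂ : Set V}
    (h₁ : G.HasTreeDecompositionOn k U₁ β₁) (h₂ : G.HasTreeDecompositionOn k U₂ β₂)
    (hβ : U₁ ∩ U₂ ⊆ β₁ ∩ β₂)
    (hadj : ∀ x ∈ U₁, ∀ y ∈ U₂, x ∉ U₂ → y ∉ U₁ → ¬ G.Adj x y) :
    G.HasTreeDecompositionOn k (U₁ ∪ U₂) β₁ := by
  obtain ⟨N₁, _, T₁, s₁, x₁, hT₁, hc₁, he₁, ha₁, hk₁, hx₁⟩ := h₁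
  obtain ⟨N₂, _, T₂, s₂, x₂, hT₂, hc₂, he₂, ha₂, hk₂, hx₂⟩ := h₂
  have hl : ∀ v i, Sum.inl i ∈ (Sum.inl '' s₁ v ∪ Sum.inr '' s₂ v : Set (N₁ ⊕ N₂)) ↔ i ∈ s₁ v := by
    simp
  have hr : ∀ v i, Sum.inr i ∈ (Sum.inl '' s₁ v ∪ Sum.inr '' s₂ v : Set (N₁ ⊕ N₂)) ↔ i ∈ s₂ v := by
    simp
  have cl : ∀ v ∈ U₁, (((T₁ ⊕g T₂) ⊔ edge (Sum.inl x₁) (Sum.inr x₂)).induce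
      (Sum.inl '' s₁ v)).Connected := fun v hv =>
    induce_image_connected Function.Embedding.inl (fun a b h => Or.inl (sum_adj_inl.2 h)) (hc₁ v hv)
  have cr : ∀ v ∈ U₂, (((T₁ ⊕g T₂) ⊔ edge (Sum.inl x₁) (Sum.inr x₂)).induce
      (Sum.inr '' s₂ v)).Connected := fun v hv =>
    induce_image_connected Function.Embedding.inr (fun a b h => Or.inl (sum_adj_inr.2 h)) (hc₂ v hv)
  refine ⟨N₁ ⊕ N₂, inferInstance, (T₁ ⊕g T₂) ⊔ edge (Sum.inl x₁) (Sum.inr x₂),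
    fun v => Sum.inl '' s₁ v ∪ Sum.inr '' s₂ v, Sum.inl x₁, hT₁.sum_sup_edge hT₂ _ _, ?_, ?_, ?_, ?_, ?_⟩
  · intro v hv
    by_cases h1 : v ∈ U₁ <;> by_cases h2 : v ∈ U₂
    · have hb := hβ ⟨h1, h2⟩
      rw [← hx₁, ← hx₂] at hb
      refine connected_induce_union (cl v h1).preconnected (cr v h2).preconnected
        (Set.mem_image_of_mem _ hb.1) (Set.mem_image_of_mem _ hb.2) (Or.inr ?_)
      simp [edge_adj]
    · have e : (Sum.inl '' s₁ v ∪ Sum.inr '' s₂ v : Set (N₁ ⊕ N₂)) = Sum.inl '' s₁ v := by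
        simp [he₂ v h2]
      beta_reduce
      rw [e]
      exact cl v h1
    · have e : (Sum.inl '' s₁ v ∪ Sum.inr '' s₂ v : Set (N₁ ⊕ N₂)) = Sum.inr '' s₂ v := by
        simp [he₁ v h1]
      beta_reduce
      rw [e]
      exact cr v h2
    · exact absurd hv (by simp [h1, h2])
  · intro v hv
    simp only [Set.mem_union, not_or] at hv
    simp [he₁ v hv.1, he₂ v hv.2]
  · intro u hu v hv huv
    have left : u ∈ U₁ → v ∈ U₁ → (((Sum.inl '' s₁ u ∪ Sum.inr '' s₂ u : Set (N₁ ⊕ N₂))) ∩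
        (Sum.inl '' s₁ v ∪ Sum.inr '' s₂ v)).Nonempty := fun h1 h2 => by
      obtain ⟨i, hi⟩ := ha₁ u h1 v h2 huv
      exact ⟨Sum.inl i, (hl _ _).2 hi.1, (hl _ _).2 hi.2⟩
    have right : u ∈ U₂ → v ∈ U₂ → (((Sum.inl '' s₁ u ∪ Sum.inr '' s₂ u : Set (N₁ ⊕ N₂))) ∩
        (Sum.inl '' s₁ v ∪ Sum.inr '' s₂ v)).Nonempty := fun h1 h2 => by
      obtain ⟨i, hi⟩ := ha₂ u h1 v h2 huv
      exact ⟨Sum.inr i, (hr _ _).2 hi.1, (hr _ _).2 hi.2⟩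
    by_cases hu1 : u ∈ U₁ <;> by_cases hu2 : u ∈ U₂ <;> by_cases hv1 : v ∈ U₁ <;>
      by_cases hv2 : v ∈ U₂ <;> first
      | exact left hu1 hv1
      | exact right hu2 hv2
      | exact absurd huv (hadj u hu1 v hv2 hu2 hv1)
      | exact absurd huv.symm (hadj v hv1 u hu2 hv2 hu1)
      | exact (hu.elim hu1 hu2).elim
      | exact (hv.elim hv1 hv2).elim
  · rintro (i | i)
    · simpa only [hl] using hk₁ i
    · simpa only [hr] using hk₂ i
  · simpa only [hl] using hx₁

theorem setWeight_indicator_one [Fintype V] (I : Finset V) (C : Set V) [DecidablePred (· ∈ C)] :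
    setWeight (Set.indicator (I : Set V) 1) C = ((I.filter (· ∈ C)).card : ℝ≥0) := by
  classical
  rw [setWeight, Finset.card_eq_sum_ones, Nat.cast_sum, Finset.sum_filter, ← Finset.sum_subset
    (Finset.subset_univ I)]
  · refine Finset.sum_congr rfl fun v hv => ?_
    by_cases h : v ∈ C <;> simp [Set.indicator, h, hv]
  · intro v _ hv
    by_cases h : v ∈ C <;> simp [Set.indicator, h, hv]

/-- The vertex sets of the components of `G - X`. -/
theorem exists_components (G : SimpleGraph V) [Finite V] (X : Set V) :
    ∃ (ι : Type u) (_ : Finite ι) (c : ι → Set V), (∀ i, (G.induce (c i)).Connected) ∧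
      (∀ i, Disjoint (c i) X) ∧ (∀ x, x ∉ X → ∃ i, x ∈ c i) ∧ (∀ i j x, x ∈ c i → x ∈ c j → i = j) ∧
      ∀ i x y, x ∈ c i → y ∉ X → G.Adj x y → y ∈ c i := by
  refine ⟨(G.induce Xᶜ).ConnectedComponent, inferInstance, fun C => Subtype.val '' C.supp,
    fun C => ?_, fun C => ?_, fun x hx => ?_, ?_, ?_⟩
  · exact induce_image_connected (T := G.induce Xᶜ) (Function.Embedding.subtype _) (fun _ _ h => h)
      C.maximal_connected_induce_supp.1
  · rw [Set.disjoint_left]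
    rintro _ ⟨y, -, rfl⟩
    exact y.2
  · exact ⟨(G.induce Xᶜ).connectedComponentMk ⟨x, hx⟩, ⟨x, hx⟩, rfl, rfl⟩
  · rintro C D _ ⟨x, hx, rfl⟩ ⟨y, hy, hxy⟩
    obtain rfl := Subtype.ext hxy
    exact (hx : _ = C).symm.trans hy
  · rintro C _ y ⟨x, hx, rfl⟩ hy hxy
    refine ⟨⟨y, hy⟩, ?_, rfl⟩
    have : (G.induce Xᶜ).Adj ⟨y, hy⟩ x := hxy.symm
    exact (ConnectedComponent.connectedComponentMk_eq_of_adj this).trans hx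

/-- Enlarge `W` until its independence number is `16d` or it is all of `U`. In the first case
balance a maximum independent set `I` of `W` by a separator `X`, recurse into each component with `X
∩ U` attached, and glue everything to the bag `W ∪ (X ∩ U)`, of independence number at most `17d`.
The pieces shrink because each misses a vertex of `I`; this needs `d ≥ 1`. -/
theorem exists_hasTreeDecompositionOn [Fintype V] {d : ℕ} (hd : 1 ≤ d)
    (hsep : ∀ w : V → ℝ≥0, ∃ Z : Set V, G.indepNumOn Z ≤ d ∧ G.IsLightSeparator w Z) (n : ℕ) :
    ∀ U W : Set V, W ⊆ U → U.ncard + (U \ W).ncard ≤ n → G.indepNumOn W ≤ 16 * d →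
      ∃ β, W ⊆ β ∧ G.HasTreeDecompositionOn (17 * d) U β := by
  classical
  induction n with
  | zero =>
    intro U W hWU hn hW
    have : U = ∅ := (Set.ncard_eq_zero (Set.toFinite _)).1 (by omega)
    exact ⟨U, hWU, .single (by rw [this, indepNumOn_empty]; omega)⟩
  | succ n ih =>
    intro U W hWU hn hW
    by_cases hUW : U ⊆ W
    · obtain rfl := hUW.antisymm hWU
      exact ⟨U, subset_rfl, .single (by omega)⟩
    by_cases hlt : G.indepNumOn W < 16 * d
    · obtain ⟨v, hvU, hvW⟩ := Set.not_subset.1 hUW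
      have h1 : (U \ insert v W).ncard < (U \ W).ncard := Set.ncard_lt_ncard
        ⟨Set.sdiff_subset_sdiff_right (Set.subset_insert _ _),
          fun h => (h ⟨hvU, hvW⟩).2 (Set.mem_insert _ _)⟩ (Set.toFinite _)
      obtain ⟨β, hβ, h⟩ := ih U (insert v W) (Set.insert_subset hvU hWU) (by omega) (by
        have := indepNumOn_union_le (G := G) {v} W
        have := indepNumOn_singleton_le (G := G) v
        rw [Set.insert_eq]
        omega)
      exact ⟨β, (Set.subset_insert _ _).trans hβ, h⟩
    obtain ⟨I, hIW, hI, hIcard⟩ := exists_isIndepSet_card_eq_indepNumOn (G := G) W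
    obtain ⟨X, hX, hXsep⟩ := hsep (Set.indicator (I : Set V) 1)
    obtain ⟨ι, _, c, hconn, hcX, hcov, hdisj, hcadj⟩ := exists_components G X
    have := Fintype.ofFinite ι
    have hbal : ∀ i, 8 * (I.filter (· ∈ c i)).card ≤ 7 * I.card := by
      intro i
      have := hXsep (c i) (hconn i) (hcX i)
      rw [setWeight_indicator_one, setWeight_indicator_one] at this
      simp only [Set.mem_univ, Finset.filter_true] at this
      exact_mod_cast this
    have hIX : (I.filter (· ∈ X)).card ≤ d := by
      refine (card_le_indepNumOn ?_ (hI.mono ?_)).trans hX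
      · intro x hx; simp at hx; exact hx.2
      · intro x hx; simp at hx; exact hx.1
    -- Of the `16d` elements of `I`, at most `14d` lie in `c i` and at most `d` in `X`.
    have hrest : ∀ i, d ≤ (I.filter (fun x => x ∉ X ∧ x ∉ c i)).card := by
      intro i
      have h1 : I = (I.filter (· ∈ X) ∪ I.filter (· ∈ c i)) ∪ I.filter (fun x => x ∉ X ∧ x ∉ c i) := by
        ext x
        simp only [Finset.mem_union, Finset.mem_filter]
        tauto
      have h2 := congrArg Finset.card h1
      have h3 := Finset.card_union_le (I.filter (· ∈ X) ∪ I.filter (· ∈ c i))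
        (I.filter (fun x => x ∉ X ∧ x ∉ c i))
      have h4 := Finset.card_union_le (I.filter (· ∈ X)) (I.filter (· ∈ c i))
      have h5 := hbal i
      omega
    -- An independent set in `W ∩ c i` stays independent when joined with the at least `d` elements
    -- of `I` in other components, and `W` allows only `16d`. This leaves room for `X ∩ U` in the
    -- recursive call.
    have hWc : ∀ i, G.indepNumOn (W ∩ c i) ≤ 15 * d := by
      intro i
      obtain ⟨J, hJW, hJ, hJcard⟩ := exists_isIndepSet_card_eq_indepNumOn (G := G) (W ∩ c i)
      have hdis : Disjoint J (I.filter (fun x => x ∉ X ∧ x ∉ c i)) := by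
        rw [Finset.disjoint_left]
        intro x hx hx'
        exact (Finset.mem_filter.1 hx').2.2 (hJW hx).2
      have := card_le_indepNumOn (G := G) (X := W) (s := J ∪ I.filter (fun x => x ∉ X ∧ x ∉ c i)) (by
        intro x hx
        rcases Finset.mem_union.1 hx with hx | hx
        · exact (hJW hx).1
        · exact hIW (Finset.mem_filter.1 hx).1) (by
        intro x hx y hy hxy
        rcases Finset.mem_union.1 hx with hx | hx <;> rcases Finset.mem_union.1 hy with hy | hy
        · exact hJ hx hy hxy
        · obtain ⟨-, h1, h2⟩ := Finset.mem_filter.1 hy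
          exact fun h => h2 (hcadj i x y (hJW hx).2 h1 h)
        · obtain ⟨-, h1, h2⟩ := Finset.mem_filter.1 hx
          exact fun h => h2 (hcadj i y x (hJW hy).2 h1 h.symm)
        · exact hI (Finset.mem_filter.1 hx).1 (Finset.mem_filter.1 hy).1 hxy)
      rw [Finset.card_union_of_disjoint hdis] at this
      have := hrest i
      omega
    set β := W ∪ (X ∩ U) with hβ
    have hβU : β ⊆ U := Set.union_subset hWU Set.inter_subset_right
    have hXU : G.indepNumOn (X ∩ U) ≤ d := (indepNumOn_mono Set.inter_subset_left).trans hX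
    have hpiece : ∀ i, ∃ γ, (W ∩ c i) ∪ (X ∩ U) ⊆ γ ∧
        G.HasTreeDecompositionOn (17 * d) ((U ∩ c i) ∪ (X ∩ U)) γ := by
      intro i
      refine ih _ _ (Set.union_subset_union_left _ (Set.inter_subset_inter_left _ hWU)) ?_ ?_
      · obtain ⟨x, hx⟩ := Finset.card_pos.1 (hd.trans (hrest i))
        obtain ⟨hxI, hxX, hxc⟩ := Finset.mem_filter.1 hx
        have h1 : ((U ∩ c i) ∪ (X ∩ U)).ncard < U.ncard := by
          refine Set.ncard_lt_ncard ⟨Set.union_subset Set.inter_subset_left Set.inter_subset_right,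
            fun h => ?_⟩ (Set.toFinite _)
          rcases h (hWU (hIW hxI)) with h | h
          · exact hxc h.2
          · exact hxX h.1
        have h2 : (((U ∩ c i) ∪ (X ∩ U)) \ ((W ∩ c i) ∪ (X ∩ U))).ncard ≤ (U \ W).ncard := by
          refine Set.ncard_le_ncard ?_ (Set.toFinite _)
          rintro x ⟨hx | hx, hx'⟩
          · exact ⟨hx.1, fun h => hx' (Or.inl ⟨h, hx.2⟩)⟩
          · exact absurd (Or.inr hx) hx'
        omega
      · have := indepNumOn_union_le (G := G) (W ∩ c i) (X ∩ U)
        have := hWc i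
        omega
    have hglue : ∀ s : Finset ι, G.HasTreeDecompositionOn (17 * d) (β ∪ ⋃ i ∈ s, U ∩ c i) β := by
      intro s
      induction s using Finset.induction_on with
      | empty =>
        have := indepNumOn_union_le (G := G) W (X ∩ U)
        simpa using HasTreeDecompositionOn.single (G := G) (k := 17 * d) (U := β)
          (this.trans (by omega))
      | insert i s his ihs =>
        obtain ⟨γ, hγ, hdec⟩ := hpiece i
        have hmem : ∀ x, x ∈ (⋃ j ∈ s, U ∩ c j) → x ∈ U ∧ x ∉ c i := by
          intro x hx
          simp only [Set.mem_iUnion] at hx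
          obtain ⟨j, hj, hxU, hxj⟩ := hx
          exact ⟨hxU, fun h => his (hdisj j i x hxj h ▸ hj)⟩
        have := ihs.glue hdec (by
          rintro x ⟨hx1, hx2⟩
          rcases hx2 with hx2 | hx2
          · rcases hx1 with hx1 | hx1
            · refine ⟨hx1, hγ ?_⟩
              rcases hx1 with h | h
              · exact Or.inl ⟨h, hx2.2⟩
              · exact Or.inr h
            · exact absurd hx2.2 (hmem x hx1).2
          · exact ⟨Or.inr hx2, hγ (Or.inr hx2)⟩) (by
          intro x hx y hy hx2 hy1 hxy
          have hxU : x ∈ U := hx.elim (fun h => hβU h) fun h => (hmem x h).1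
          have hxX : x ∉ X := fun h => hx2 (Or.inr ⟨h, hxU⟩)
          rcases hy with hy | hy
          · exact hx2 (Or.inl ⟨hxU, hcadj i y x hy.2 hxX hxy.symm⟩)
          · exact hy1 (Or.inl (Or.inr hy)))
        convert this using 1
        rw [Finset.set_biUnion_insert]
        ext x
        simp only [Set.mem_union, hβ]
        tauto
    refine ⟨β, Set.subset_union_left, ?_⟩
    convert hglue Finset.univ using 1
    ext x
    constructor
    · intro hx
      by_cases hxX : x ∈ X
      · exact Or.inl (Or.inr ⟨hxX, hx⟩)
      · obtain ⟨i, hi⟩ := hcov x hxX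
        exact Or.inr (Set.mem_iUnion₂.2 ⟨i, Finset.mem_univ i, hx, hi⟩)
    · rintro (hx | hx)
      · exact hβU hx
      · obtain ⟨i, -, hi⟩ := Set.mem_iUnion₂.1 hx
        exact hi.1

theorem treeIndepNum_le_of_lightSeparators [Fintype V] {d : ℕ} (hd : 1 ≤ d)
    (hsep : ∀ w : V → ℝ≥0, ∃ Z : Set V, G.indepNumOn Z ≤ d ∧ G.IsLightSeparator w Z) :
    G.treeIndepNum ≤ 17 * d := by
  obtain ⟨β, -, N, hN, T, s, x, hT, hc, -, ha, hk, -⟩ := exists_hasTreeDecompositionOn hd hsep _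
    Set.univ ∅ (Set.empty_subset _) le_rfl (by rw [indepNumOn_empty]; omega)
  let D : G.TreeDecomposition :=
    { Node := N
      finite_node := hN
      tree := T
      isTree := hT
      subtree := s
      subtree_connected := fun v => hc v (Set.mem_univ v)
      exists_common_node := fun u v => ha u (Set.mem_univ u) v (Set.mem_univ v) }
  exact (ciInf_le' _ D).trans ((D.alphaWidth_le_iff _).2 hk)

end TreeDecompositions
end SimpleGraph

/-! ### Separator functions and the final bounds. -/

-- Light separators are defined for weightings of any total, so a nonzero weighting is normalised
-- first. A connected set avoiding the separator lies in one component of the rest.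
open SimpleGraph in
theorem IsSeparatorFunction.hasNbhdSeparators {g : ℕ → ℕ} (hg : IsSeparatorFunction.{u} g) {t : ℕ}
    (ht : 2 ≤ t) : HasNbhdSeparators.{u} 1 (g t) t := by
  intro V _ G hG hfree w
  by_cases hw : setWeight w Set.univ = 0
  · refine ⟨∅, by simp, ∅, by simp [indepNumOn_empty], fun C _ _ => ?_⟩
    have := setWeight_mono w (Set.subset_univ C)
    rw [hw] at this ⊢
    simp [le_antisymm this zero_le]
  have hscale : ∀ X : Set V, setWeight (fun v => (setWeight w Set.univ)⁻¹ * w v) X =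
      (setWeight w Set.univ)⁻¹ * setWeight w X := by
    intro X
    simp only [setWeight, Finset.mul_sum]
    refine Finset.sum_congr rfl fun v _ => ?_
    by_cases h : v ∈ X <;> simp [Set.indicator, h]
  obtain ⟨z, Z, hZ, hsep⟩ := hg t ht V G hG hfree (fun v => (setWeight w Set.univ)⁻¹ * w v) (by
    rw [hscale, inv_mul_cancel₀ hw])
  refine ⟨{z}, by simp, Z, hZ, fun C hC hd => ?_⟩
  have hCS : Disjoint C (insert z (G.neighborSet z) ∪ Z) := by
    refine hd.mono_right (Set.union_subset_union_left _ ?_)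
    rintro x (rfl | hx)
    · exact ⟨x, by simp, Or.inl rfl⟩
    · exact ⟨z, by simp, Or.inr hx⟩
  set S := insert z (G.neighborSet z) ∪ Z with hS
  have hCS' : C ⊆ Sᶜ := fun x hx => Set.disjoint_left.1 hCS hx
  obtain ⟨x, hx⟩ := hC.nonempty
  have hsub : C ⊆ Subtype.val '' ((G.induce Sᶜ).connectedComponentMk ⟨x, hCS' hx⟩).supp := by
    intro y hy
    refine ⟨⟨y, hCS' hy⟩, ?_, rfl⟩
    exact ConnectedComponent.sound
      ((hC.preconnected ⟨y, hy⟩ ⟨x, hx⟩).map (induceHomOfLE G hCS').toHom)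
  have h1 := hsep ((G.induce Sᶜ).connectedComponentMk ⟨x, hCS' hx⟩)
  rw [hscale, hscale, inv_mul_cancel₀ hw, mul_one] at h1
  have h2 := setWeight_mono w hsub
  have hpos : 0 < setWeight w Set.univ := pos_iff_ne_zero.2 hw
  rw [inv_mul_le_iff₀ hpos] at h1
  calc 8 * setWeight w C ≤ 8 * (setWeight w Set.univ * (7 / 8)) :=
        mul_le_mul_right (h2.trans h1) 8
    _ = 7 * setWeight w Set.univ := by
        rw [mul_comm (setWeight w Set.univ), ← mul_assoc, mul_div_cancel₀ _ (by norm_num)]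

open SimpleGraph in
theorem SimpleGraph.HasNbhdSeparators.isSeparatorFunction {g : ℕ → ℕ}
    (hg : ∀ t, 2 ≤ t → HasNbhdSeparators.{u} 0 (g t) t) : IsSeparatorFunction.{u} g := by
  intro t ht V _ G hG hfree w _
  obtain ⟨X, hX, Z, hZ, hsep⟩ := hg t ht V G hG hfree w
  obtain rfl : X = ∅ := Finset.card_eq_zero.1 (Nat.le_zero.1 hX)
  refine ⟨hG.nonempty.some, Z, hZ, fun D => ?_⟩
  have h := hsep (Subtype.val '' D.supp)
    (induce_image_connected (T := G.induce _) (Function.Embedding.subtype _) (fun _ _ h => h)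
      D.maximal_connected_induce_supp.1) (by
      rw [Set.disjoint_left]
      rintro _ ⟨y, -, rfl⟩ (h | h)
      · simp [closedNbhd] at h
      · exact y.2 (Or.inr h))
  rw [div_mul_eq_mul_div, le_div_iff₀ (by norm_num), mul_comm]
  exact h

/-- The explicit bound in terms of a separator function. -/
theorem IsSeparatorFunction.treeIndepNum_le {g : ℕ → ℕ} (hg : IsSeparatorFunction.{u} g) {t : ℕ}
    (ht : 2 ≤ t) {V : Type u} [Fintype V] {G : SimpleGraph V} (hG : G.IsPathBicliqueFree 6 t) :
    G.treeIndepNum ≤ 238 * (t - 1) + 34 * g t + 119 := by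
  have := SimpleGraph.treeIndepNum_le_of_lightSeparators (G := G) (d := 6 * (t - 1) + 3 + 2 * g t)
    (by omega) fun w => by
      -- The trade from one neighbourhood to none does not need `G` connected, since it applies the
      -- hypothesis only inside a component of `G - K`.
      obtain ⟨X, hX, Z, hZ, hsep⟩ := (hg.hasNbhdSeparators ht).exists_of_succ ht hG w
      obtain rfl : X = ∅ := Finset.card_eq_zero.1 (Nat.le_zero.1 hX)
      exact ⟨Z, hZ, by simpa [SimpleGraph.closedNbhd] using hsep⟩
  -- The argument gives `17(6(t-1)+3+2g(t)) = 102(t-1)+34g(t)+51`, within the stated bound.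
  omega

theorem exists_isSeparatorFunction : ∃ g : ℕ → ℕ, IsSeparatorFunction.{u} g := by
  have key : ∀ t, ∃ m, 2 ≤ t → SimpleGraph.HasNbhdSeparators.{u} 0 m t := by
    intro t
    by_cases ht : 2 ≤ t
    -- Iterating `m ↦ 6(t-1)+3+2m` five times from `0` gives `31(6(t-1)+3)`.
    · exact ⟨_, fun _ => ((((SimpleGraph.hasNbhdSeparators_five t).of_succ ht).of_succ ht).of_succ
        ht).of_succ ht |>.of_succ ht⟩
    · exact ⟨0, fun h => absurd h ht⟩
  choose g hg using key
  exact ⟨g, SimpleGraph.HasNbhdSeparators.isSeparatorFunction hg⟩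

namespace SimpleGraph
variable {V : Type u} {G : SimpleGraph V}

theorem IsPathBicliqueFree.mono {r r' t t' : ℕ} (hr : r ≤ r') (ht : t ≤ t')
    (hG : G.IsPathBicliqueFree r t) : G.IsPathBicliqueFree r' t' := by
  refine ⟨fun ⟨f⟩ => hG.1 ⟨f.comp ⟨Fin.castLEEmb hr, ?_⟩⟩, fun ⟨f⟩ => hG.2 ⟨f.comp
    ⟨(Function.Embedding.refl _).sumMap (Fin.castLEEmb ht), ?_⟩⟩⟩
  · intro a b
    simp [pathGraph_adj]
  · rintro (a | a) (b | b) <;> simp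

end SimpleGraph

theorem theorem1p3 :
    -- boundedness for `{P_6, K_{2,t}}`-free graphs
    (∀ t : ℕ, 2 ≤ t → ∃ s : ℕ, ∀ (V : Type u) [Fintype V] (G : SimpleGraph V),
      G.IsPathBicliqueFree 6 t → G.treeIndepNum ≤ s) ∧
    -- the explicit bound, in terms of any function `g` with the separator property
    (∃ g : ℕ → ℕ, IsSeparatorFunction.{u} g) ∧
    (∀ g : ℕ → ℕ, IsSeparatorFunction.{u} g →
      ∀ t : ℕ, 2 ≤ t → ∀ (V : Type u) [Fintype V] (G : SimpleGraph V),
        G.IsPathBicliqueFree 6 t →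
          G.treeIndepNum ≤ 238 * (t - 1) + 34 * g t + 119) ∧
    -- boundedness for `{P_r, K_{2,t}}`-free graphs with `r ≤ 6`
    (∀ r t : ℕ, 1 ≤ r → r ≤ 6 → 1 ≤ t →
      ∃ s : ℕ, ∀ (V : Type u) [Fintype V] (G : SimpleGraph V),
        G.IsPathBicliqueFree r t → G.treeIndepNum ≤ s) := by
  obtain ⟨g, hg⟩ := exists_isSeparatorFunction.{u}
  refine ⟨fun t ht => ⟨_, fun V _ G hG => hg.treeIndepNum_le ht hG⟩, ⟨g, hg⟩,
    fun g hg t ht V _ G hG => hg.treeIndepNum_le ht hG, fun r t _ hr _ => ?_⟩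
  -- Freeness is monotone in both parameters, so `r` is raised to `6` and `t` to at least `2`.
  exact ⟨_, fun V _ G hG => hg.treeIndepNum_le (le_max_right t 2) (hG.mono hr (le_max_left t 2))⟩
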